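/- Let $q=2^h$ with $h\ge 3$, let $\alpha$ be a primitive element of the finite field $\mathbb F_q$, put $\alpha_i=\alpha^i$ for $1\le i\le q-1$, and let $3\le k\le q-4$. Let $\mathcal C_k\subseteq\mathbb F_q^{\,q-1}$ be the linear code generated by the $k$ vectors $(\alpha_1^{e},\alpha_2^{e},\ldots,\alpha_{q-1}^{e})$ with $e\in\{0,1,\ldots,k-2,k\}$, and let $\mathcal C_k^\perp$ be its Euclidean dual. Let $A_i$ and $A_i^\perp$ be the numbers of codewords of Hamming weight $i$ in $\mathcal C_k$ and $\mathcal C_k^\perp$. For integers $i,j\ge 0$ with $i+j\le k-2$ put $$N(i,j)=\begin{cases}\frac1q\left[\binom{q-1}{k-i-j-2}+(-1)^{k-i-j+\lfloor\frac{k-i-j}{2}\rfloor-1}(q-1)\binom{\frac q2-1}{\lfloor\frac{k-i-j}{2}\rfloor-1}\right] & \text{if } ij \text{ is odd},\\[2mm] \frac1q\left[\binom{q-1}{k-i-j-2}+(-1)^{k-i-j+\lfloor\frac{k-i-j}{2}\rfloor}\binom{\frac q2-1}{\lfloor\frac{k-i-j}{2}\rfloor-1}\right] & \text{if } ij \text{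 is even},\end{cases}$$ and $\lambda_1=\sum_{i=0}^{k-2}\sum_{j=0}^{k-2-i}(-1)^{i+j}N(i,j)$. Then the weight enumerators $A(z)=\sum_{i=0}^{q-1}A_iz^i$ of $\mathcal C_k$ and $A^\perp(z)=\sum_{i=0}^{q-1}A_i^\perp z^i$ of $\mathcal C_k^\perp$ are $$A(z)=1+\sum_{i=q-k-1}^{q-1}A_iz^i,\qquad A^\perp(z)=1+\sum_{i=k}^{q-1}A^\perp_iz^i,$$ where the numbers of codewords of minimum weight are $$A_{q-k-1}=A_k^\perp=\frac{\lambda_1(q-1)^2(q-2)}{k(k-1)}>0,$$ and the remaining coefficients are given, for $s\in\{1,2,\ldots,k\}$, by $$A_{q-1-k+s}=\binom{q-1}{k-s}\sum_{i=0}^{s-1}(-1)^i\binom{q-1-k+s}{i}(q^{s-i}-1)+(-1)^s\binom ks A_{q-k-1},$$ and, for $s\in\{1,2,\ldots,q-1-k\}$, by $$A^\perp_{k+s}=\binom{q-1}{k+s}\sum_{i=0}^{s-1}(-1)^i\binom{k+s}{i}(q^{s-i}-1)+(-1)^s\binom{q-1-k}{s}A_k^\perp.$$ -/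

import Mathlib

open Polynomial

/-- The Euclidean dual `C^⊥ = {y | ∑ x_i y_i = 0 for all x ∈ C}` of a linear code `C ≤ F^ι`. -/
def dualCode {F ι : Type*} [Field F] [Fintype ι] (C : Submodule F (ι → F)) :
    Submodule F (ι → F) where
  carrier := {y | ∀ x ∈ C, x ⬝ᵥ y = 0}
  zero_mem' := fun x _ => dotProduct_zero x
  add_mem' := fun ha hb x hx => by rw [dotProduct_add, ha x hx, hb x hx, add_zero]
  smul_mem' := fun c y hy x hx => by rw [dotProduct_smul, hy x hx, smul_zero]

/-- The number `A_w` of codewords of Hamming weight `w` in `C`. -/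
noncomputable def weightCount {F ι : Type*} [Field F] [DecidableEq F] [Fintype ι]
    (C : Submodule F (ι → F)) (w : ℕ) : ℕ :=
  Set.ncard {c : ι → F | c ∈ C ∧ hammingNorm c = w}

/-- The polynomial weight enumerator `∑_{i=0}^n A_i z^i` of a code of length `n = |ι|`. -/
noncomputable def weightEnumerator {F ι : Type*} [Field F] [DecidableEq F] [Fintype ι]
    (C : Submodule F (ι → F)) : ℤ[X] :=
  ∑ i ∈ Finset.range (Fintype.card ι + 1), Polynomial.C (weightCount C i : ℤ) * X ^ i

/-- The `k × n` matrix whose rows are the `e`-th powers of `(α^1, α^2, …, α^n)` for the exponents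
`e = 0, 1, …, k-2, k` (in this order; the exponent `k-1` is skipped). -/
def genMatrix {F : Type*} [Field F] (α : F) (n k : ℕ) : Matrix (Fin k) (Fin n) F :=
  Matrix.of fun r i => (α ^ (i.val + 1)) ^ (if r.val + 1 = k then k else r.val)

/-- The code `C_k` of length `n` generated by the rows of `genMatrix α n k`. -/
def codeC {F : Type*} [Field F] (α : F) (n k : ℕ) : Submodule F (Fin n → F) :=
  Submodule.span F (Set.range (genMatrix α n k).row)

/-- The rational number `N(i, j)` (depending on `q` and `k`), for `i + j ≤ k - 2`. -/
def subsetN (q k i j : ℕ) : ℚ :=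
  if Odd (i * j) then
    1 / (q : ℚ) * (((q - 1).choose (k - i - j - 2) : ℚ) +
      (-1) ^ (k - i - j + (k - i - j) / 2 - 1) * ((q : ℚ) - 1) *
        ((q / 2 - 1).choose ((k - i - j) / 2 - 1) : ℚ))
  else
    1 / (q : ℚ) * (((q - 1).choose (k - i - j - 2) : ℚ) +
      (-1) ^ (k - i - j + (k - i - j) / 2) *
        ((q / 2 - 1).choose ((k - i - j) / 2 - 1) : ℚ))

/-- `λ₁ = ∑_{i=0}^{k-2} ∑_{j=0}^{k-2-i} (-1)^{i+j} N(i, j)`. -/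
def lambdaOne (q k : ℕ) : ℚ :=
  ∑ i ∈ Finset.range (k - 2 + 1), ∑ j ∈ Finset.range (k - 2 - i + 1),
    (-1) ^ (i + j) * subsetN q k i j

/-! Counting pairs (codeword, `t`-set of its zeros) in two ways expresses the sums of `vanishCount C
T` over `t`-sets through the weight distribution, and binomial inversion recovers the latter. A word
of `codeC` is the evaluation at all nonzero field elements of a polynomial of degree at most `k`
without `X^(k-1)` term. Hence `vanishCount` is `1` on sets larger than `k` and `q^(k-|T|)` on
smaller ones; only sets of size exactly `k` depend on `T`. There the polynomial must be a multiple
of `∏ (X - x_j)`, whose `X^(k-1)` coefficient is minus the sum of the roots, so the count is `q` or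
`1` according as the points sum to zero or not. Thus one number, the number `M` of zero-sum
`k`-subsets of the nonzero elements, fixes the whole weight distribution, with minimum-weight count
`(q-1)M`. Rank-nullity for the restriction of the code to `T` ties words vanishing on `T` to dual
words supported on `T`. So the dual has the same three-case shape with `n - k` for `k` and the same
middle sum, and the same inversion applies to it. To evaluate `M`, a nontrivial additive character,
which is `±1`-valued in characteristic two, counts the `m`-subsets of the nonzero elements with
given sum. Inclusion-exclusion on two marked elements turns these counts into `λ₁`, and double
counting pairs in zero-sum sets gives `k(k-1)M = λ₁(q-1)(q-2)`. Positivity follows because the main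
binomial dominates the character term. -/

/-! ### Zero counts and weight distributions -/

/-- The number of codewords of `C` that vanish on the coordinates in `T`. -/
noncomputable def vanishCount {F ι : Type*} [Field F] [Fintype ι]
    (C : Submodule F (ι → F)) (T : Finset ι) : ℕ :=
  Set.ncard {c : ι → F | c ∈ C ∧ ∀ i ∈ T, c i = 0}

/-- Double counting the pairs of a codeword and a `t`-set of its zeros. -/
theorem sum_vanishCount {F ι : Type*} [Field F] [Fintype F] [DecidableEq F] [Fintype ι]
    (C : Submodule F (ι → F)) (t : ℕ) :
    ∑ T ∈ Finset.powersetCard t (Finset.univ : Finset ι), vanishCount C T =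
      ∑ w ∈ Finset.range (Fintype.card ι + 1),
        weightCount C w * (Fintype.card ι - w).choose t := by
  classical
  have h1 : ∀ T : Finset ι, vanishCount C T =
      ((Finset.univ.filter (· ∈ C)).filter fun c : ι → F => ∀ i ∈ T, c i = 0).card := by
    intro T
    rw [vanishCount, ← Set.ncard_coe_finset]
    congr 1
    ext c
    simp
  have h2 : ∀ w : ℕ, weightCount C w =
      ((Finset.univ.filter (· ∈ C)).filter fun c : ι → F => hammingNorm c = w).card := by
    intro w
    rw [weightCount, ← Set.ncard_coe_finset]
    congr 1
    ext c
    simp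
  simp_rw [h1]
  have h3 := Finset.sum_card_bipartiteAbove_eq_sum_card_bipartiteBelow
    (s := Finset.powersetCard t (Finset.univ : Finset ι))
    (t := Finset.univ.filter fun c : ι → F => c ∈ C) (fun T c => ∀ i ∈ T, c i = 0)
  simp only [Finset.bipartiteAbove, Finset.bipartiteBelow] at h3
  rw [h3]
  have h4 : ∀ c : ι → F, ((Finset.powersetCard t (Finset.univ : Finset ι)).filter
      fun T => ∀ i ∈ T, c i = 0).card = (Fintype.card ι - hammingNorm c).choose t := by
    intro c
    have h5 : (Finset.powersetCard t (Finset.univ : Finset ι)).filter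
        (fun T => ∀ i ∈ T, c i = 0) =
        Finset.powersetCard t (Finset.univ.filter fun i => c i = 0) := by
      ext T
      simp only [Finset.mem_filter, Finset.mem_powersetCard, Finset.subset_iff, Finset.mem_univ,
        true_and, implies_true]
      tauto
    rw [h5, Finset.card_powersetCard]
    congr 1
    have h6 := Finset.card_filter_add_card_filter_not (s := (Finset.univ : Finset ι))
      (fun i => c i = 0)
    rw [Finset.card_univ] at h6
    have h7 : hammingNorm c = (Finset.univ.filter fun i => ¬ c i = 0).card := rfl
    omega
  simp_rw [h4]
  rw [← Finset.sum_fiberwise_of_maps_to (t := Finset.range (Fintype.card ι + 1))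
    (g := fun c : ι → F => hammingNorm c)
    (fun c _ => Finset.mem_range.2 (Nat.lt_succ_of_le hammingNorm_le_card_fintype))]
  refine Finset.sum_congr rfl fun w _ => ?_
  rw [h2, Finset.sum_congr rfl (g := fun _ => (Fintype.card ι - w).choose t)
    (fun c hc => by rw [(Finset.mem_filter.1 hc).2]), Finset.sum_const, smul_eq_mul]

/-- Compare coefficients of `X^m` in `X^z = ((X - 1) + 1)^z`. This is the orthogonality relation
that inverts `sum_vanishCount`; the truncated exponent `t - m` is harmless, since `t.choose m = 0`
for `t < m`. -/
theorem sum_neg_one_pow_mul_choose_mul_choose (n z m : ℕ) (hz : z ≤ n) :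
    ∑ t ∈ Finset.range (n + 1), (-1 : ℚ) ^ (t - m) * (t.choose m) * (z.choose t) =
      if z = m then 1 else 0 := by
  have h1 : (X : ℚ[X]) ^ z = ∑ t ∈ Finset.range (z + 1), C (z.choose t : ℚ) * (X + C (-1)) ^ t := by
    conv_lhs => rw [show (X : ℚ[X]) = (X + C (-1)) + 1 by simp, add_pow]
    refine Finset.sum_congr rfl fun t _ => ?_
    simp [mul_comm]
  have h2 := congrArg (fun p => p.coeff m) h1
  simp only [coeff_X_pow, finsetSum_coeff, coeff_C_mul, coeff_X_add_C_pow] at h2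
  rw [show (if z = m then (1 : ℚ) else 0) = if m = z then 1 else 0 by simp [eq_comm], h2]
  symm
  apply Finset.sum_subset_zero_on_sdiff
  · intro t ht
    simp only [Finset.mem_range] at *
    omega
  · intro t ht
    simp only [Finset.mem_sdiff, Finset.mem_range] at ht
    rw [Nat.choose_eq_zero_of_lt (show z < t by omega)]
    simp
  · intro t _
    ring

/-- The weight distribution of a code, recovered from the zero counts of its codewords. -/
theorem weightCount_eq_sum_vanishCount {F ι : Type*} [Field F] [Fintype F] [DecidableEq F]
    [Fintype ι] (C : Submodule F (ι → F)) (m : ℕ) (hm : m ≤ Fintype.card ι) :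
    (weightCount C (Fintype.card ι - m) : ℚ) =
      ∑ t ∈ Finset.range (Fintype.card ι + 1), (-1 : ℚ) ^ (t - m) * (t.choose m) *
        (∑ T ∈ Finset.powersetCard t (Finset.univ : Finset ι), vanishCount C T : ℕ) := by
  simp_rw [sum_vanishCount]
  push_cast
  simp_rw [Finset.mul_sum]
  rw [Finset.sum_comm]
  have h1 : ∀ w ∈ Finset.range (Fintype.card ι + 1),
      ∑ t ∈ Finset.range (Fintype.card ι + 1), (-1 : ℚ) ^ (t - m) * (t.choose m) *
        ((weightCount C w : ℚ) * ((Fintype.card ι - w).choose t : ℚ)) =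
      if w = Fintype.card ι - m then (weightCount C w : ℚ) else 0 := by
    intro w hw
    rw [Finset.mem_range] at hw
    have h2 := sum_neg_one_pow_mul_choose_mul_choose (Fintype.card ι) (Fintype.card ι - w) m
      (Nat.sub_le _ _)
    calc _ = (weightCount C w : ℚ) * ∑ t ∈ Finset.range (Fintype.card ι + 1),
          (-1 : ℚ) ^ (t - m) * (t.choose m) * ((Fintype.card ι - w).choose t : ℚ) := by
          rw [Finset.mul_sum]
          exact Finset.sum_congr rfl fun t _ => by ring
      _ = _ := by
          rw [h2, mul_ite, mul_one, mul_zero]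
          congr 1
          rw [eq_iff_iff]
          omega
  rw [Finset.sum_congr rfl h1, Finset.sum_ite_eq' , if_pos (Finset.mem_range.2 (by omega))]

/-- The weight distribution of a code in which every `t < k` coordinates carry the
uniform distribution and no nonzero codeword has more than `k` zeros. -/
theorem weightCount_of_vanishCount {F ι : Type*} [Field F] [Fintype F] [DecidableEq F]
    [Fintype ι] (C : Submodule F (ι → F)) (n q k A : ℕ) (hn : Fintype.card ι = n) (hk : k < n)
    (hlow : ∀ T : Finset ι, T.card < k → vanishCount C T = q ^ (k - T.card))
    (hhigh : ∀ T : Finset ι, k < T.card → vanishCount C T = 1)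
    (hmid : ∑ T ∈ Finset.powersetCard k (Finset.univ : Finset ι), vanishCount C T =
      n.choose k + A) :
    weightCount C 0 = 1 ∧ (∀ w, 0 < w → w < n - k → weightCount C w = 0) ∧
      weightCount C (n - k) = A ∧
      ∀ s ∈ Finset.Icc 1 k, (weightCount C (n - k + s) : ℚ) =
        (n.choose (k - s) : ℚ) * ∑ i ∈ Finset.range s,
          (-1) ^ i * ((n - k + s).choose i : ℚ) * ((q : ℚ) ^ (s - i) - 1) +
        (-1) ^ s * (k.choose s : ℚ) * (A : ℚ) := by
  subst hn
  set n := Fintype.card ι with hn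
  -- `e t` is the excess over the contribution `n.choose t` of the zero codeword; it vanishes for `t
  -- > k`.
  set e : ℕ → ℚ := fun t => if t < k then (n.choose t : ℚ) * ((q : ℚ) ^ (k - t) - 1)
    else if t = k then A else 0 with he
  have hN : ∀ t, ((∑ T ∈ Finset.powersetCard t (Finset.univ : Finset ι), vanishCount C T : ℕ) : ℚ)
      = n.choose t + e t := by
    intro t
    rcases lt_trichotomy t k with ht | ht | ht
    · rw [Finset.sum_congr rfl (g := fun _ => q ^ (k - t))]
      · simp only [Finset.sum_const, Finset.card_powersetCard, Finset.card_univ, smul_eq_mul, he,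
          if_pos ht]
        push_cast
        ring
      · intro T hT
        have := (Finset.mem_powersetCard.1 hT).2
        rw [hlow T (by omega), this]
    · subst ht
      rw [hmid]
      simp [he]
    · rw [Finset.sum_congr rfl (g := fun _ => 1)]
      · simp only [Finset.sum_const, Finset.card_powersetCard, Finset.card_univ, smul_eq_mul, he,
          if_neg ht.not_gt, if_neg ht.ne']
        push_cast
        ring
      · intro T hT
        have := (Finset.mem_powersetCard.1 hT).2
        rw [hhigh T (by omega)]
  -- By the inversion identity with `z = n`, the zero codeword's part contributes only to weight
  -- `0`.
  have key : ∀ m ≤ n, (weightCount C (n - m) : ℚ) = (if n = m then 1 else 0) +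
      ∑ t ∈ Finset.range (k + 1), (-1 : ℚ) ^ (t - m) * (t.choose m) * e t := by
    intro m hm
    rw [weightCount_eq_sum_vanishCount C m hm, ← hn,
      ← sum_neg_one_pow_mul_choose_mul_choose n n m le_rfl]
    simp_rw [hN, mul_add, Finset.sum_add_distrib]
    congr 1
    symm
    apply Finset.sum_subset
    · intro t ht
      simp only [Finset.mem_range] at *
      omega
    · intro t _ ht
      rw [Finset.mem_range] at ht
      simp only [he, if_neg (show ¬ t < k by omega), if_neg (show ¬ t = k by omega), mul_zero]
  have hzero : ∀ m, k < m →
      ∑ t ∈ Finset.range (k + 1), (-1 : ℚ) ^ (t - m) * (t.choose m) * e t = 0 := by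
    intro m hm
    refine Finset.sum_eq_zero fun t ht => ?_
    rw [Finset.mem_range] at ht
    rw [Nat.choose_eq_zero_of_lt (show t < m by omega)]
    simp
  refine ⟨?_, ?_, ?_, ?_⟩
  · have := key n le_rfl
    rw [hzero n hk] at this
    simpa using this
  · intro w h0 hw
    have := key (n - w) (Nat.sub_le _ _)
    rw [hzero _ (by omega), if_neg (by omega), show n - (n - w) = w by omega] at this
    simpa using this
  · have := key k hk.le
    rw [if_neg (by omega), Finset.sum_range_succ, Finset.sum_eq_zero] at this
    · simpa [he] using this
    · intro t ht
      rw [Finset.mem_range] at ht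
      rw [Nat.choose_eq_zero_of_lt ht]
      simp
  · intro s hs
    rw [Finset.mem_Icc] at hs
    -- Here `m = k - s` is the number of zeros. Terms `t < m` vanish, `t = m + i` with `i < s` gives
    -- the main sum, and `t = k` gives the term with `A`.
    obtain ⟨m, rfl⟩ : ∃ m, k = m + s := ⟨k - s, by omega⟩
    have := key m (by omega)
    rw [if_neg (by omega), zero_add, Finset.sum_range_succ, Finset.sum_range_add,
      Finset.sum_eq_zero, zero_add] at this
    · rw [show n - (m + s) + s = n - m by omega, this, Nat.add_sub_cancel, Finset.mul_sum]
      congr 1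
      · refine Finset.sum_congr rfl fun i hi => ?_
        rw [Finset.mem_range] at hi
        have h1 := Nat.choose_mul (n := n) (k := m + i) (s := m) (by omega)
        rw [Nat.add_sub_cancel_left] at h1
        have h2 : ((n.choose (m + i) : ℚ) * ((m + i).choose m)) = n.choose m * (n - m).choose i := by
          exact_mod_cast h1
        simp only [he, if_pos (show m + i < m + s by omega), Nat.add_sub_cancel_left,
          Nat.add_sub_add_left]
        linear_combination ((-1) ^ i * ((q : ℚ) ^ (s - i) - 1)) * h2
      · have h3 : (m + s).choose m = (m + s).choose s := Nat.choose_symm_add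
        simp [he, h3]
    · intro t ht
      rw [Finset.mem_range] at ht
      rw [Nat.choose_eq_zero_of_lt ht]
      simp

/-! ### Duality of zero counts -/

theorem vanishCount_empty {F ι : Type*} [Field F] [Fintype F] [Fintype ι]
    (C : Submodule F (ι → F)) : vanishCount C ∅ = Fintype.card F ^ Module.finrank F C := by
  rw [vanishCount, ← Nat.card_eq_fintype_card, ← Module.natCard_eq_pow_finrank,
    ← Nat.card_coe_set_eq]
  exact Nat.card_congr (Equiv.subtypeEquivRight (by simp))

/-- The codewords of the dual code that are supported on `T` are governed by the codewords of
`C` that vanish on `T`. -/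
theorem vanishCount_dualCode {F ι : Type*} [Field F] [Fintype F] [Fintype ι] [DecidableEq ι]
    (C : Submodule F (ι → F)) (T : Finset ι) :
    vanishCount (dualCode C) Tᶜ * vanishCount C ∅ =
      Fintype.card F ^ T.card * vanishCount C T := by
  classical
  -- Restriction to `T`: its kernel is the subcode vanishing on `T`, and the annihilator of its
  -- range is, by extension by zero, the set of dual words supported on `T`. The identity is then
  -- rank-nullity plus the dimension formula for annihilators.
  set ρ : C →ₗ[F] (T → F) := (LinearMap.funLeft F F (fun i : T => (i : ι))).comp C.subtype with hρ
  have e2 : vanishCount C T = Fintype.card F ^ Module.finrank F (LinearMap.ker ρ) := by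
    rw [vanishCount, ← Nat.card_eq_fintype_card, ← Module.natCard_eq_pow_finrank (K := F) (V := LinearMap.ker ρ),
      ← Nat.card_coe_set_eq]
    refine Nat.card_congr ⟨fun c => ⟨⟨c.1, c.2.1⟩, ?_⟩, fun c => ⟨c.1.1, c.1.2, ?_⟩, fun c => rfl,
      fun c => rfl⟩
    · rw [LinearMap.mem_ker]
      ext i
      exact c.2.2 i i.2
    · intro i hi
      exact congrFun (LinearMap.mem_ker.1 c.2) ⟨i, hi⟩
  have e3 : vanishCount (dualCode C) Tᶜ =
      Fintype.card F ^ Module.finrank F (LinearMap.range ρ).dualAnnihilator := by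
    rw [vanishCount, ← Nat.card_eq_fintype_card, 
      ← Module.natCard_eq_pow_finrank (K := F) (V := (LinearMap.range ρ).dualAnnihilator),
      ← Nat.card_coe_set_eq]
    have hsum : ∀ (x y : ι → F), (∀ i ∈ Tᶜ, y i = 0) → x ⬝ᵥ y = ∑ i : T, y i * x i := by
      intro x y hy
      rw [Finset.sum_coe_sort T (fun i => y i * x i), dotProduct]
      symm
      rw [Finset.sum_subset (Finset.subset_univ T)]
      · exact Finset.sum_congr rfl fun i _ => mul_comm _ _
      · intro i _ hi
        rw [hy i (by simpa using hi), zero_mul]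
    refine Nat.card_congr (Equiv.ofBijective
      (fun y => ⟨dotProductEquiv F T (fun i => y.1 i), ?_⟩) ⟨?_, ?_⟩)
    · rw [Submodule.mem_dualAnnihilator]
      rintro _ ⟨x, rfl⟩
      have := y.2.1 x x.2
      rw [hsum _ _ y.2.2] at this
      simpa [dotProductEquiv, dotProduct, hρ] using this
    · intro y z hyz
      have h1 := (dotProductEquiv F T).injective (Subtype.ext_iff.1 hyz)
      ext i
      by_cases hi : i ∈ T
      · exact congrFun h1 ⟨i, hi⟩
      · rw [y.2.2 i (by simpa using hi), z.2.2 i (by simpa using hi)]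
    · rintro ⟨φ, hφ⟩
      obtain ⟨v, rfl⟩ := (dotProductEquiv F T).surjective φ
      have hv : ∀ i ∈ Tᶜ, (fun i => if h : i ∈ T then v ⟨i, h⟩ else 0) i = 0 := by
        intro i hi
        simp [Finset.mem_compl.1 hi]
      refine ⟨⟨fun i => if h : i ∈ T then v ⟨i, h⟩ else 0, ?_, hv⟩, ?_⟩
      · intro x hx
        rw [hsum _ _ hv]
        have := (Submodule.mem_dualAnnihilator _).1 hφ _ ⟨⟨x, hx⟩, rfl⟩
        simpa [dotProductEquiv, dotProduct, hρ] using this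
      · apply Subtype.ext
        simp
  have h1 := LinearMap.finrank_range_add_finrank_ker ρ
  have h2 := Subspace.finrank_add_finrank_dualAnnihilator_eq (LinearMap.range ρ)
  rw [Module.finrank_pi, Fintype.card_coe] at h2
  rw [vanishCount_empty, e2, e3, ← pow_add, ← pow_add, ← h1, ← h2]
  congr 1
  ring

/-! ### Subset sums of the nonzero elements in characteristic two -/

/-- The number of `m`-subsets of `A` with sum `b`. -/
def subsetSumCount {F : Type*} [Field F] [DecidableEq F] (A : Finset F) (m : ℕ) (b : F) : ℕ :=
  ((A.powersetCard m).filter fun S => ∑ a ∈ S, a = b).card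

theorem subsetSumCount_zero {F : Type*} [Field F] [DecidableEq F] (A B : Finset F) (b : F) :
    subsetSumCount A 0 b = subsetSumCount B 0 b := by
  simp [subsetSumCount]

/-- Deleting `U` is a bijection onto the `m`-subsets of `A`, and it shifts the sum by that of `U`.
-/
theorem card_filter_subset_subsetSum {F : Type*} [Field F] [DecidableEq F] {A U : Finset F}
    (hU : Disjoint U A) (m : ℕ) (b : F) :
    (((U ∪ A).powersetCard (m + U.card)).filter fun S => ∑ a ∈ S, a = b ∧ U ⊆ S).card =
      subsetSumCount A m (b - ∑ a ∈ U, a) := by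
  unfold subsetSumCount
  refine Finset.card_nbij' (fun S => S \ U) (fun S => U ∪ S) ?_ ?_ ?_ ?_
  · intro S hS
    simp only [Finset.coe_filter, Finset.mem_powersetCard, Set.mem_ofPred_eq] at hS ⊢
    obtain ⟨⟨h1, h2⟩, h3, h4⟩ := hS
    refine ⟨⟨?_, ?_⟩, ?_⟩
    · rw [sdiff_le_iff]
      exact h1
    · rw [Finset.card_sdiff_of_subset h4, h2, Nat.add_sub_cancel]
    · rw [← h3, ← Finset.sum_sdiff h4, add_sub_cancel_right]
  · intro S hS
    simp only [Finset.coe_filter, Finset.mem_powersetCard, Set.mem_ofPred_eq] at hS ⊢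
    obtain ⟨⟨h1, h2⟩, h3⟩ := hS
    have h4 : Disjoint U S := hU.mono_right h1
    refine ⟨⟨Finset.union_subset_union_right h1, ?_⟩, ?_, Finset.subset_union_left⟩
    · rw [Finset.card_union_of_disjoint h4, h2, add_comm]
    · rw [Finset.sum_union h4, h3, add_sub_cancel]
  · intro S hS
    simp only [Finset.coe_filter, Set.mem_ofPred_eq] at hS
    exact Finset.union_sdiff_of_subset hS.2.2
  · intro S hS
    simp only [Finset.coe_filter, Finset.mem_powersetCard, Set.mem_ofPred_eq] at hS
    exact Finset.union_sdiff_cancel_left (hU.mono_right hS.1.1)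

theorem subsetSumCount_insert {F : Type*} [Field F] [DecidableEq F] {A : Finset F} {x : F}
    (hx : x ∉ A) (m : ℕ) (b : F) :
    subsetSumCount (insert x A) (m + 1) b =
      subsetSumCount A (m + 1) b + subsetSumCount A m (b - x) := by
  have h0 := card_filter_subset_subsetSum (Finset.disjoint_singleton_left.2 hx) m b
  simp only [Finset.card_singleton, Finset.sum_singleton, Finset.singleton_subset_iff,
    ← Finset.insert_eq] at h0
  rw [← h0]
  unfold subsetSumCount
  rw [← Finset.card_filter_add_card_filter_not (fun S => x ∈ S), add_comm, Finset.filter_filter,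
    Finset.filter_filter]
  congr 2
  ext S
  simp only [Finset.mem_filter, Finset.mem_powersetCard]
  constructor
  · rintro ⟨⟨h1, h2⟩, h3, h4⟩
    exact ⟨⟨(Finset.subset_insert_iff_of_notMem h4).1 h1, h2⟩, h3⟩
  · rintro ⟨⟨h1, h2⟩, h3⟩
    exact ⟨⟨h1.trans (Finset.subset_insert x A), h2⟩, h3, fun h => hx (h1 h)⟩

/-- Inclusion-exclusion: the subset sums of `A` in terms of those of `insert x A`. -/
theorem subsetSumCount_eq_sum_insert {F : Type*} [Field F] [DecidableEq F] {A : Finset F} {x : F}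
    (hx : x ∉ A) (m : ℕ) (b : F) :
    (subsetSumCount A m b : ℚ) = ∑ i ∈ Finset.range (m + 1),
      (-1) ^ i * (subsetSumCount (insert x A) (m - i) (b - i * x) : ℚ) := by
  induction m generalizing b with
  | zero => simp [subsetSumCount_zero A (insert x A)]
  | succ m ih =>
    rw [Finset.sum_range_succ']
    have h1 : (subsetSumCount (insert x A) (m + 1) b : ℚ) =
      subsetSumCount A (m + 1) b + subsetSumCount A m (b - x) := by
      exact_mod_cast subsetSumCount_insert hx m b
    -- The tail is the induction hypothesis at `b - x` with the sign flipped: it removes the subsets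
    -- containing `x`.
    have h2 : ∑ i ∈ Finset.range (m + 1), (-1 : ℚ) ^ (i + 1) *
        (subsetSumCount (insert x A) (m + 1 - (i + 1)) (b - ((i + 1 : ℕ) : F) * x) : ℚ) =
        - subsetSumCount A m (b - x) := by
      rw [ih, ← Finset.sum_neg_distrib]
      refine Finset.sum_congr rfl fun i _ => ?_
      rw [Nat.add_sub_add_right, show b - ((i + 1 : ℕ) : F) * x = b - x - i * x by push_cast; ring]
      ring
    rw [h2]
    simp [h1]

theorem sum_subsetSumCount {F : Type*} [Field F] [Fintype F] [DecidableEq F]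
    (A : Finset F) (m : ℕ) : ∑ b : F, subsetSumCount A m b = A.card.choose m := by
  rw [← Finset.card_powersetCard]
  exact (Finset.card_eq_sum_card_fiberwise fun _ _ => Finset.mem_univ _).symm

/-- Scaling by `c` permutes the nonzero elements. Hence all nonzero sums are equally frequent, and
only the values at `0` and `1` matter. -/
theorem subsetSumCount_mul {F : Type*} [Field F] [Fintype F] [DecidableEq F] (m : ℕ) {c : F}
    (hc : c ≠ 0) (b : F) : subsetSumCount (Finset.univ.erase 0) m (c * b) =
      subsetSumCount (Finset.univ.erase (0 : F)) m b := by
  have key : ∀ c : F, c ≠ 0 → ∀ b : F, subsetSumCount (Finset.univ.erase (0 : F)) m b ≤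
      subsetSumCount (Finset.univ.erase (0 : F)) m (c * b) := by
    intro c hc b
    unfold subsetSumCount
    refine Finset.card_le_card_of_injOn (fun S => S.map ⟨fun a => c * a, mul_right_injective₀ hc⟩) ?_
      (Finset.map_injective _).injOn
    intro S hS
    simp only [Finset.coe_filter, Finset.mem_powersetCard, Set.mem_ofPred_eq] at hS ⊢
    obtain ⟨⟨h1, h2⟩, h3⟩ := hS
    refine ⟨⟨?_, by rw [Finset.card_map, h2]⟩, ?_⟩
    · intro a ha
      obtain ⟨a', ha', rfl⟩ := Finset.mem_map.1 ha
      simpa [hc] using h1 ha'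
    · rw [Finset.sum_map, ← h3, Finset.mul_sum]
      rfl
  refine le_antisymm ?_ (key c hc b)
  have := key c⁻¹ (inv_ne_zero hc) (c * b)
  rwa [inv_mul_cancel_left₀ hc] at this

/-- Since `(1 - X^2)^N` is even, just one of its coefficients at `m` and `m - 1` can contribute; the
parity of `m` fixes the sign. -/
theorem coeff_one_sub_X_mul_pow (N m : ℕ) :
    ((1 - X) * (1 - X ^ 2) ^ N : ℂ[X]).coeff m =
      (-1) ^ (m + m / 2) * (N.choose (m / 2) : ℂ) := by
  have h1 : ((1 - X ^ 2) ^ N : ℂ[X]) = expand ℂ 2 ((1 - X) ^ N) := by simp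
  have h2 : ∀ j, ((1 - X : ℂ[X]) ^ N).coeff j = (-1) ^ j * (N.choose j : ℂ) := by
    intro j
    have : (1 - X : ℂ[X]) ^ N = ((1 + X) ^ N).comp (C (-1) * X) := by
      simp [sub_eq_add_neg]
    rw [this, comp_C_mul_X_coeff, coeff_one_add_X_pow, mul_comm]
  have h3 : ∀ j, ((1 - X ^ 2 : ℂ[X]) ^ N).coeff j =
      if 2 ∣ j then (-1) ^ (j / 2) * (N.choose (j / 2) : ℂ) else 0 := by
    intro j
    rw [h1, coeff_expand two_pos, h2]
  rw [sub_mul, one_mul, coeff_sub, h3]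
  cases m with
  | zero => simp
  | succ m =>
    rw [coeff_X_mul, h3]
    rcases Nat.even_or_odd' m with ⟨j, rfl | rfl⟩
    · rw [if_neg (by omega), if_pos (by omega), show (2 * j + 1) / 2 = j by omega,
        show 2 * j / 2 = j by omega, pow_add (-1 : ℂ) (2 * j + 1), pow_succ, pow_mul]
      simp
    · rw [if_pos (by omega), if_neg (by omega), show (2 * j + 1 + 1) / 2 = j + 1 by omega,
        show 2 * j + 1 + 1 = 2 * (j + 1) by omega, pow_add (-1 : ℂ) (2 * (j + 1)), pow_mul]
      simp

/-- In characteristic two, the subset sums of the nonzero elements that vanish exceed those of a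
nonzero value by a signed binomial coefficient. -/
theorem subsetSumCount_zero_sub_one {F : Type*} [Field F] [Fintype F] [DecidableEq F] [CharP F 2]
    (m : ℕ) : (subsetSumCount (Finset.univ.erase (0 : F)) m 0 : ℚ) -
      subsetSumCount (Finset.univ.erase (0 : F)) m 1 =
      (-1) ^ (m + m / 2) * ((Fintype.card F / 2 - 1).choose (m / 2) : ℚ) := by
  -- The generating function is the product of `1 + ψ(a)X` over `a ≠ 0`. As `ψ` takes the value `1`
  -- at `q/2 - 1` nonzero elements and `-1` at `q/2`, it equals `(1 - X)(1 - X^2)^(q/2 - 1)`. Its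
  -- `X^m` coefficient is the sum of count times `ψ(b)` over `b`, which collapses to the required
  -- difference because `ψ` sums to `-1` over the nonzero elements.
  obtain ⟨ψ, hψ⟩ := (AddChar.exists_apply_ne_zero (a := (1 : F))).2 one_ne_zero
  have hψ0 : ψ ≠ 0 := by
    rintro rfl
    simp at hψ
  have hsum : ∑ a, ψ a = 0 := AddChar.sum_eq_zero_iff_ne_zero.2 hψ0
  have hsq : ∀ a, ψ a = 1 ∨ ψ a = -1 := by
    intro a
    rw [← sq_eq_one_iff, sq, ← AddChar.map_add_eq_mul, CharTwo.add_self_eq_zero,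
      AddChar.map_zero_eq_one]
  set A := Finset.univ.erase (0 : F) with hA
  set N := (A.filter fun a => ψ a = 1).card with hN
  have hfil : ∀ a ∈ A.filter (fun a => ¬ ψ a = 1), ψ a = -1 := fun a ha =>
    (hsq a).resolve_left (Finset.mem_filter.1 ha).2
  have hsumA : ∑ a ∈ A, ψ a = -1 := by
    rw [← Finset.add_sum_erase _ _ (Finset.mem_univ (0 : F)), AddChar.map_zero_eq_one] at hsum
    linear_combination hsum
  have hM : (A.filter fun a => ¬ ψ a = 1).card = N + 1 := by
    rw [← Finset.sum_filter_add_sum_filter_not A (fun a => ψ a = 1), Finset.sum_congr rfl hfil,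
      Finset.sum_congr rfl (fun a ha => (Finset.mem_filter.1 ha).2)] at hsumA
    simp only [Finset.sum_const, nsmul_eq_mul, mul_one, mul_neg] at hsumA
    have : ((A.filter fun a => ¬ ψ a = 1).card : ℂ) = (N + 1 : ℕ) := by
      push_cast
      linear_combination -hsumA
    exact_mod_cast this
  have hcard : Fintype.card F / 2 - 1 = N := by
    have h1 := Finset.card_filter_add_card_filter_not (s := A) (fun a => ψ a = 1)
    rw [hM, hA, Finset.card_erase_of_mem (Finset.mem_univ _), Finset.card_univ, ← hA, ← hN] at h1
    omega
  have h1 : ∏ a ∈ A, (1 + C (ψ a) * X : ℂ[X]) = (1 - X) * (1 - X ^ 2) ^ N := by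
    have hplus : ∏ a ∈ A.filter (fun a => ψ a = 1), (1 + C (ψ a) * X : ℂ[X]) = (1 + X) ^ N := by
      rw [hN, ← Finset.prod_const]
      exact Finset.prod_congr rfl fun a ha => by rw [(Finset.mem_filter.1 ha).2]; simp
    have hminus : ∏ a ∈ A.filter (fun a => ¬ ψ a = 1), (1 + C (ψ a) * X : ℂ[X]) =
        (1 - X) ^ (N + 1) := by
      rw [← hM, ← Finset.prod_const]
      exact Finset.prod_congr rfl fun a ha => by rw [hfil a ha]; simp [sub_eq_add_neg]
    rw [← Finset.prod_filter_mul_prod_filter_not A (fun a => ψ a = 1), hplus, hminus, pow_succ,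
      ← mul_assoc, ← mul_pow]
    ring
  have h2 : (∏ a ∈ A, (1 + C (ψ a) * X : ℂ[X])).coeff m =
      (subsetSumCount A m 0 : ℂ) - subsetSumCount A m 1 := by
    rw [Finset.prod_one_add, finsetSum_coeff]
    have hmap : ∀ S : Finset F, ψ (∑ a ∈ S, a) = ∏ a ∈ S, ψ a := by
      intro S
      induction S using Finset.induction_on with
      | empty => simp
      | insert a S ha ih =>
        rw [Finset.sum_insert ha, Finset.prod_insert ha, AddChar.map_add_eq_mul, ih]
    have h3 : ∀ S : Finset F, (∏ a ∈ S, (C (ψ a) * X : ℂ[X])).coeff m =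
        if S.card = m then ψ (∑ a ∈ S, a) else 0 := by
      intro S
      rw [Finset.prod_mul_distrib, Finset.prod_const, ← map_prod, coeff_C_mul_X_pow,
        ← hmap]
      simp [eq_comm]
    simp_rw [h3]
    rw [← Finset.sum_filter, ← Finset.powersetCard_eq_filter,
      ← Finset.sum_fiberwise_of_maps_to (t := Finset.univ) (g := fun S : Finset F => ∑ a ∈ S, a)
        (fun _ _ => Finset.mem_univ _)]
    have h4 : ∀ b : F, ∑ S ∈ (A.powersetCard m).filter (fun S => ∑ a ∈ S, a = b),
        ψ (∑ a ∈ S, a) = subsetSumCount A m b * ψ b := by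
      intro b
      rw [Finset.sum_congr rfl (fun S hS => by rw [(Finset.mem_filter.1 hS).2]),
        Finset.sum_const, nsmul_eq_mul]
      rfl
    simp_rw [h4]
    rw [← Finset.add_sum_erase _ _ (Finset.mem_univ (0 : F)),
      Finset.sum_congr rfl (g := fun b => (subsetSumCount A m 1 : ℂ) * ψ b), ← Finset.mul_sum,
      hsumA, AddChar.map_zero_eq_one]
    · ring
    · intro b hb
      have := subsetSumCount_mul m (Finset.ne_of_mem_erase hb) 1
      rw [mul_one] at this
      rw [this]
  rw [h1, coeff_one_sub_X_mul_pow] at h2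
  rw [hcard]
  exact_mod_cast h2.symm

/-- The number of `m`-subsets of the nonzero elements of a finite field of characteristic two
with a prescribed sum. -/
theorem subsetSumCount_eq {F : Type*} [Field F] [Fintype F] [DecidableEq F] [CharP F 2]
    (m : ℕ) (b : F) : (subsetSumCount (Finset.univ.erase (0 : F)) m b : ℚ) =
      1 / (Fintype.card F : ℚ) * ((Fintype.card F - 1).choose m +
        (if b = 0 then (Fintype.card F : ℚ) - 1 else -1) *
          ((-1) ^ (m + m / 2) * ((Fintype.card F / 2 - 1).choose (m / 2) : ℚ))) := by
  -- Two linear equations for the counts at `0` and `1`: their difference, and the total over all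
  -- sums.
  have h1 := subsetSumCount_zero_sub_one (F := F) m
  have h2 := sum_subsetSumCount (Finset.univ.erase (0 : F)) m
  rw [← Finset.add_sum_erase _ _ (Finset.mem_univ (0 : F)), Finset.sum_congr rfl
    (g := fun _ => subsetSumCount (Finset.univ.erase (0 : F)) m 1), Finset.sum_const,
    Finset.card_erase_of_mem (Finset.mem_univ _), Finset.card_univ, smul_eq_mul] at h2
  · have hq : (Fintype.card F : ℚ) ≠ 0 := by simp
    have h3 := congrArg (Nat.cast : ℕ → ℚ) h2
    push_cast [Nat.cast_sub Fintype.card_pos] at h3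
    have h4 : (subsetSumCount (Finset.univ.erase (0 : F)) m b : ℚ) =
        if b = 0 then (subsetSumCount (Finset.univ.erase (0 : F)) m 0 : ℚ)
          else subsetSumCount (Finset.univ.erase (0 : F)) m 1 := by
      split_ifs with hb
      · rw [hb]
      · have := subsetSumCount_mul m hb 1
        rw [mul_one] at this
        rw [this]
    rw [h4, ← h1, ← h3]
    split_ifs
    · field_simp
      ring
    · field_simp
      ring
  · intro b hb
    have := subsetSumCount_mul m (Finset.ne_of_mem_erase hb) 1
    rwa [mul_one] at this

/-- In characteristic two the target is `(1+i)x + (1+j)y`, which vanishes exactly when `i` and `j`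
are both odd, because `x`, `y` and `x + y` are nonzero. This is the source of the case split on
`ij`. -/
theorem subsetN_eq_subsetSumCount {F : Type*} [Field F] [Fintype F] [DecidableEq F] [CharP F 2]
    {x y : F} (hx : x ≠ 0) (hy : y ≠ 0) (hxy : x ≠ y) (k i j : ℕ) (hk : 2 ≤ k)
    (hij : i + j ≤ k - 2) : subsetN (Fintype.card F) k i j =
      subsetSumCount (Finset.univ.erase (0 : F)) (k - 2 - i - j) (0 - (x + y) - i * x - j * y) := by
  obtain ⟨m, rfl⟩ : ∃ m, k = m + 2 + i + j := ⟨k - 2 - i - j, by omega⟩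
  have hcast : ∀ i : ℕ, (i : F) = if Odd i then 1 else 0 := by
    intro i
    split_ifs with hi
    · obtain ⟨a, rfl⟩ := hi
      simp [CharTwo.two_eq_zero]
    · obtain ⟨a, rfl⟩ := Nat.not_odd_iff_even.1 hi
      simp [CharTwo.add_self_eq_zero]
  have h1 : 0 - (x + y) - i * x - j * y = 0 ↔ Odd (i * j) := by
    rw [Nat.odd_mul, hcast i, hcast j, show (0 : F) - (x + y) = x + y by rw [zero_sub, CharTwo.neg_eq]]
    have h2 : x + y ≠ 0 := by rwa [Ne, CharTwo.add_eq_zero]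
    by_cases hi : Odd i <;> by_cases hj : Odd j <;> simp [hi, hj, hx, hy, h2]
  rw [subsetSumCount_eq, subsetN, show m + 2 + i + j - i - j = m + 2 by omega,
    show m + 2 + i + j - 2 - i - j = m by omega, show (m + 2) / 2 = m / 2 + 1 by omega]
  simp only [h1, Nat.add_sub_cancel]
  -- Against `m + m/2` the sign exponent shifts by `2` when `ij` is odd and by `3` otherwise; the
  -- extra sign is the factor `-1` of a nonzero target.
  rw [show m + 2 + (m / 2 + 1) - 1 = (m + m / 2) + 2 by omega,
    show m + 2 + (m / 2 + 1) = (m + m / 2) + 3 by omega, pow_add, pow_add]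
  split_ifs <;> ring

/-- `λ₁` counts the `k`-subsets of sum zero of the nonzero elements that contain two given
elements. -/
theorem lambdaOne_eq_subsetSumCount {F : Type*} [Field F] [Fintype F] [DecidableEq F] [CharP F 2]
    {x y : F} (hx : x ≠ 0) (hy : y ≠ 0) (hxy : x ≠ y) (k : ℕ) (hk : 2 ≤ k) :
    lambdaOne (Fintype.card F) k =
      subsetSumCount (((Finset.univ.erase (0 : F)).erase y).erase x) (k - 2) (0 - (x + y)) := by
  rw [subsetSumCount_eq_sum_insert (Finset.notMem_erase x _), Finset.insert_erase (by simp [hx, hxy])]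
  unfold lambdaOne
  refine Finset.sum_congr rfl fun i hi => ?_
  rw [subsetSumCount_eq_sum_insert (Finset.notMem_erase y _), Finset.insert_erase (by simp [hy]),
    Finset.mul_sum]
  refine Finset.sum_congr rfl fun j hj => ?_
  rw [Finset.mem_range] at hi hj
  rw [subsetN_eq_subsetSumCount hx hy hxy k i j hk (by omega), pow_add, mul_assoc]

/-- The number of `k`-subsets of the nonzero elements with sum zero, in terms of `λ₁`. -/
theorem mul_subsetSumCount_zero {F : Type*} [Field F] [Fintype F] [DecidableEq F] [CharP F 2]
    (k : ℕ) (hk : 2 ≤ k) :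
    (k : ℚ) * (k - 1) * subsetSumCount (Finset.univ.erase (0 : F)) k 0 =
      lambdaOne (Fintype.card F) k * ((Fintype.card F : ℚ) - 1) * ((Fintype.card F : ℚ) - 2) := by
  set A := Finset.univ.erase (0 : F) with hA
  have hAc : A.card = Fintype.card F - 1 := by
    rw [hA, Finset.card_erase_of_mem (Finset.mem_univ _), Finset.card_univ]
  -- Double count zero-sum `k`-sets together with an ordered pair of distinct members; each pair
  -- lies in `λ₁` such sets.
  have h0 := Finset.sum_card_bipartiteAbove_eq_sum_card_bipartiteBelow
    (s := (A.powersetCard k).filter fun S => ∑ a ∈ S, a = 0) (t := A.offDiag)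
    (fun S p => p.1 ∈ S ∧ p.2 ∈ S)
  simp only [Finset.bipartiteAbove, Finset.bipartiteBelow] at h0
  rw [Finset.sum_congr rfl (g := fun _ => k * k - k)] at h0
  · have h1 := congrArg (Nat.cast : ℕ → ℚ) h0
    push_cast at h1
    suffices hR : ∀ p ∈ A.offDiag, (((((A.powersetCard k).filter fun S => ∑ a ∈ S, a = 0).filter
        fun S => p.1 ∈ S ∧ p.2 ∈ S).card : ℕ) : ℚ) = lambdaOne (Fintype.card F) k by
      rw [Finset.sum_congr rfl hR] at h1
      rw [Finset.sum_const, Finset.sum_const, Finset.offDiag_card, hAc, nsmul_eq_mul, nsmul_eq_mul,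
        Nat.cast_sub (Nat.le_mul_self k), Nat.cast_sub (Nat.le_mul_self _)] at h1
      push_cast [Nat.cast_sub Fintype.card_pos] at h1
      have h2 : (((A.powersetCard k).filter fun S => ∑ a ∈ S, a = 0).card : ℚ) =
        subsetSumCount A k 0 := rfl
      rw [h2] at h1
      linear_combination h1
    · rintro ⟨x, y⟩ hp
      rw [Finset.mem_offDiag] at hp
      obtain ⟨hx, hy, hxy⟩ := hp
      simp only at hx hy hxy
      rw [lambdaOne_eq_subsetSumCount (Finset.ne_of_mem_erase hx) (Finset.ne_of_mem_erase hy)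
        hxy k hk]
      have hd : Disjoint ({x, y} : Finset F) ((A.erase y).erase x) := by
        rw [Finset.disjoint_left]
        intro a ha
        simp only [Finset.mem_insert, Finset.mem_singleton] at ha
        simp only [Finset.mem_erase]
        tauto
      have h3 := card_filter_subset_subsetSum hd (k - 2) 0
      rw [Finset.card_pair hxy, Finset.sum_pair hxy, Nat.sub_add_cancel hk] at h3
      have h4 : {x, y} ∪ (A.erase y).erase x = A := by
        ext a
        simp only [Finset.mem_union, Finset.mem_insert, Finset.mem_singleton, Finset.mem_erase]
        grind
      rw [← h3, Finset.filter_filter, h4]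
      simp [Finset.insert_subset_iff]
  · intro S hS
    rw [Finset.mem_filter, Finset.mem_powersetCard] at hS
    obtain ⟨⟨h1, h2⟩, -⟩ := hS
    rw [← h2, ← Finset.offDiag_card]
    congr 1
    ext ⟨x, y⟩
    simp only [Finset.mem_filter, Finset.mem_offDiag]
    constructor
    · tauto
    · rintro ⟨hx, hy, hxy⟩
      exact ⟨⟨h1 hx, h1 hy, hxy⟩, hx, hy⟩

/-! ### Existence of zero-sum `k`-subsets -/

theorem le_choose_of_pos_of_lt {n j : ℕ} (h1 : 0 < j) (h2 : j < n) : n ≤ n.choose j := by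
  induction n generalizing j with
  | zero => simp
  | succ n ih =>
    obtain ⟨j, rfl⟩ : ∃ i, j = i + 1 := ⟨j - 1, by omega⟩
    rw [Nat.choose_succ_succ']
    rcases Nat.lt_or_ge (j + 1) n with h | h
    · have := ih h1 h
      have := Nat.choose_pos (n := n) (k := j) (by omega)
      omega
    · obtain rfl : n = j + 1 := by omega
      rw [Nat.choose_self, Nat.choose_succ_self_right]

/-- Split the right side by Pascal and bound both parts below by Vandermonde terms: one square and
two mixed products, each at least `n * n.choose (k / 2)`. The total `3n` beats `2n + 1` since `n ≥
2`. -/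
theorem mul_choose_half_lt_choose {n k : ℕ} (hn : 2 ≤ n) (hk : 3 ≤ k) (hkn : k ≤ 2 * n - 2) :
    (2 * n + 1) * n.choose (k / 2) < (2 * n + 1).choose k := by
  have hv : ∀ a b, n.choose a * n.choose b ≤ (2 * n).choose (a + b) := by
    intro a b
    rw [two_mul, Nat.add_choose_eq]
    exact Finset.single_le_sum (f := fun ij : ℕ × ℕ => n.choose ij.1 * n.choose ij.2)
      (a := (a, b)) (fun _ _ => Nat.zero_le _) (Finset.HasAntidiagonal.mem_antidiagonal.2 rfl)
  have hv2 : ∀ a, n.choose a * n.choose (a + 1) + n.choose (a + 1) * n.choose a ≤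
      (2 * n).choose (a + (a + 1)) := by
    intro a
    rw [two_mul, Nat.add_choose_eq]
    have := Finset.sum_le_sum_of_subset (f := fun ij : ℕ × ℕ => n.choose ij.1 * n.choose ij.2)
      (show ({(a, a + 1), (a + 1, a)} : Finset (ℕ × ℕ)) ⊆ Finset.HasAntidiagonal.antidiagonal (a + (a + 1)) by
        intro p hp
        simp only [Finset.mem_insert, Finset.mem_singleton] at hp
        rcases hp with rfl | rfl <;>
          simp [Finset.HasAntidiagonal.mem_antidiagonal, add_comm])
    rwa [Finset.sum_pair (by simp)] at this
  obtain ⟨j, rfl | rfl⟩ := Nat.even_or_odd' k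
  · obtain ⟨i, rfl⟩ : ∃ i, j = i + 1 := ⟨j - 1, by omega⟩
    rw [show 2 * (i + 1) / 2 = i + 1 by omega, show 2 * (i + 1) = (i + (i + 1)) + 1 by ring,
      Nat.choose_succ_succ]
    have h1 := hv2 i
    have h2 := hv (i + 1) (i + 1)
    rw [show i + 1 + (i + 1) = i + (i + 1) + 1 by ring] at h2
    have h3 := le_choose_of_pos_of_lt (n := n) (j := i) (by omega) (by omega)
    have h4 := le_choose_of_pos_of_lt (n := n) (j := i + 1) (by omega) (by omega)
    have h5 := Nat.mul_le_mul_right (n.choose (i + 1)) h3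
    have h6 := Nat.mul_le_mul_right (n.choose (i + 1)) h4
    nlinarith
  · rw [show (2 * j + 1) / 2 = j by omega, Nat.choose_succ_succ]
    have h1 := hv2 j
    have h2 := hv j j
    rw [show j + (j + 1) = 2 * j + 1 by ring] at h1
    rw [show j + j = 2 * j by ring] at h2
    have h3 := le_choose_of_pos_of_lt (n := n) (j := j) (by omega) (by omega)
    have h4 := le_choose_of_pos_of_lt (n := n) (j := j + 1) (by omega) (by omega)
    have h5 := Nat.mul_le_mul_right (n.choose j) h3
    have h6 := Nat.mul_le_mul_right (n.choose j) h4
    nlinarith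

/-- With `q = 2n + 2`, the main binomial of the explicit count exceeds the character term even when
the latter is negative. -/
theorem subsetSumCount_zero_pos {F : Type*} [Field F] [Fintype F] [DecidableEq F] [CharP F 2]
    (hF : 2 ∣ Fintype.card F) (k : ℕ) (hk : 3 ≤ k) (hkq : k ≤ Fintype.card F - 4) :
    0 < subsetSumCount (Finset.univ.erase (0 : F)) k 0 := by
  obtain ⟨n, hn⟩ : ∃ n, Fintype.card F = 2 * n + 2 := by
    obtain ⟨a, ha⟩ := hF
    exact ⟨a - 1, by omega⟩
  have h1 := mul_choose_half_lt_choose (n := n) (k := k) (by omega) hk (by omega)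
  have h2 := subsetSumCount_eq (F := F) k 0
  rw [if_pos rfl, hn, show 2 * n + 2 - 1 = 2 * n + 1 by omega,
    show (2 * n + 2) / 2 - 1 = n by omega] at h2
  have h3 : ((2 * n + 1 : ℚ)) * n.choose (k / 2) < (2 * n + 1).choose k := by exact_mod_cast h1
  have h4 : (0 : ℚ) < subsetSumCount (Finset.univ.erase (0 : F)) k 0 := by
    rw [h2]
    apply mul_pos (by positivity)
    push_cast
    rcases neg_one_pow_eq_or ℚ (k + k / 2) with h | h
    · rw [h]
      have : (0 : ℚ) ≤ (2 * n + 1) * n.choose (k / 2) := by positivity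
      linarith
    · rw [h]
      linarith
  exact_mod_cast h4

/-! ### The code as evaluations of polynomials -/

theorem mem_codeC {F : Type*} [Field F] (α : F) (n k : ℕ) (hk : 1 ≤ k) (c : Fin n → F) :
    c ∈ codeC α n k ↔ ∃ p : F[X], p.natDegree ≤ k ∧ p.coeff (k - 1) = 0 ∧
      ∀ i : Fin n, c i = p.eval (α ^ (i.val + 1)) := by
  constructor
  · intro hc
    induction hc using Submodule.span_induction with
    | mem c hc =>
      obtain ⟨r, rfl⟩ := hc
      refine ⟨X ^ (if r.val + 1 = k then k else r.val), ?_, ?_, ?_⟩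
      · rw [natDegree_X_pow]
        split_ifs <;> omega
      · rw [coeff_X_pow, if_neg]
        split_ifs <;> omega
      · intro i
        rw [eval_pow, eval_X]
        rfl
    | zero => exact ⟨0, by simp, by simp, by simp⟩
    | add c d _ _ hc hd =>
      obtain ⟨p, hp1, hp2, hp3⟩ := hc
      obtain ⟨r, hr1, hr2, hr3⟩ := hd
      exact ⟨p + r, natDegree_add_le_of_degree_le hp1 hr1, by simp [hp2, hr2],
        fun i => by simp [hp3, hr3]⟩
    | smul a c _ hc =>
      obtain ⟨p, hp1, hp2, hp3⟩ := hc
      exact ⟨C a * p, (natDegree_C_mul_le a p).trans hp1, by simp [hp2], fun i => by simp [hp3]⟩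
  · rintro ⟨p, hp1, hp2, hp3⟩
    have h1 : c = ∑ j ∈ Finset.range (k + 1),
        p.coeff j • (fun i : Fin n => (α ^ (i.val + 1)) ^ j) := by
      ext i
      rw [hp3, eval_eq_sum_range' (Nat.lt_succ_of_le hp1), Finset.sum_apply]
      rfl
    rw [h1]
    refine Submodule.sum_mem _ fun j hj => ?_
    rw [Finset.mem_range] at hj
    by_cases hj1 : j = k - 1
    · rw [hj1, hp2, zero_smul]
      exact Submodule.zero_mem _
    refine Submodule.smul_mem _ _ (Submodule.subset_span ?_)
    rcases Nat.lt_or_ge j (k - 1) with hlt | hge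
    · refine ⟨⟨j, by omega⟩, ?_⟩
      ext i
      simp [genMatrix, Matrix.row, show j + 1 ≠ k by omega]
    · refine ⟨⟨k - 1, by omega⟩, ?_⟩
      ext i
      simp [genMatrix, Matrix.row, show k - 1 + 1 = k by omega, show j = k by omega]

theorem powers_injective {F : Type*} [Field F] {α : F} {n : ℕ} (hα : IsPrimitiveRoot α n) :
    Function.Injective fun i : Fin n => α ^ (i.val + 1) := by
  intro i j hij
  have h0 : α ≠ 0 := hα.ne_zero (by have := i.2; omega)
  simp only [pow_succ] at hij
  exact Fin.ext (hα.pow_inj i.2 j.2 (mul_right_cancel₀ h0 hij))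

/-- A relation among the rows is a polynomial of degree at most `k < n` with `n` distinct roots. -/
theorem finrank_codeC {F : Type*} [Field F] {α : F} {n k : ℕ} (hα : IsPrimitiveRoot α n)
    (hkn : k < n) : Module.finrank F (codeC α n k) = k := by
  have hli : LinearIndependent F (genMatrix α n k).row := by
    rw [Fintype.linearIndependent_iff]
    intro a ha r
    set e : Fin k → ℕ := fun r => if r.val + 1 = k then k else r.val with he
    have hinj : Function.Injective e := by
      intro r s hrs
      simp only [he] at hrs
      apply Fin.ext
      have := r.2
      have := s.2
      split_ifs at hrs <;> omega
    set p : F[X] := ∑ r, C (a r) * X ^ e r with hp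
    have hp0 : p = 0 := by
      refine eq_zero_of_natDegree_lt_card_of_eval_eq_zero p (powers_injective hα) ?_ ?_
      · intro i
        have := congrFun ha i
        rw [Finset.sum_apply] at this
        rw [hp, eval_finsetSum]
        simp only [eval_mul, eval_C, eval_pow, eval_X]
        exact this
      · rw [Fintype.card_fin]
        refine lt_of_le_of_lt (natDegree_sum_le_of_forall_le (n := k) _ _ fun r _ => ?_) hkn
        refine (natDegree_C_mul_X_pow_le _ _).trans ?_
        have := r.2
        simp only [he]
        split_ifs <;> omega
    have := congrArg (fun p => p.coeff (e r)) hp0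
    simpa [hp, finsetSum_coeff, coeff_C_mul, coeff_X_pow, hinj.eq_iff] using this
  rw [codeC, finrank_span_eq_card hli, Fintype.card_fin]

theorem vanishCount_eq_one {F ι : Type*} [Field F] [Fintype ι] (C : Submodule F (ι → F))
    (T : Finset ι) (h : ∀ c ∈ C, (∀ i ∈ T, c i = 0) → c = 0) : vanishCount C T = 1 := by
  rw [vanishCount, Set.ncard_eq_one]
  refine ⟨0, Set.eq_singleton_iff_unique_mem.2 ⟨⟨C.zero_mem, fun _ _ => rfl⟩, fun c hc => ?_⟩⟩
  exact h c hc.1 hc.2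

/-- By duality it suffices that no nonzero dual word is supported on fewer than `k` coordinates. -/
theorem vanishCount_codeC_of_lt {F : Type*} [Field F] [Fintype F] {α : F} {n k : ℕ}
    (hα : IsPrimitiveRoot α n) (hk : 1 ≤ k) (hkn : k < n) (T : Finset (Fin n))
    (hT : T.card < k) : vanishCount (codeC α n k) T = Fintype.card F ^ (k - T.card) := by
  have h1 := vanishCount_dualCode (codeC α n k) T
  rw [vanishCount_empty, finrank_codeC hα hkn, vanishCount_eq_one, one_mul,
    ← pow_mul_pow_sub (Fintype.card F) hT.le] at h1
  · exact (Nat.eq_of_mul_eq_mul_left (pow_pos Fintype.card_pos _) h1).symm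
  · intro y hy hyT
    ext i
    by_cases hi : i ∈ T
    -- Pairing `y` with this codeword isolates `y i`. Its degree `|T| - 1` is below `k - 1`, so the
    -- forbidden coefficient is zero.
    · set p : F[X] := ∏ j ∈ T.erase i, (X - C (α ^ (j.val + 1))) with hp
      have hdeg : p.natDegree = T.card - 1 := by
        rw [hp, natDegree_finsetProd_X_sub_C_eq_card, Finset.card_erase_of_mem hi]
      have hpos : 0 < T.card := Finset.card_pos.2 ⟨i, hi⟩
      have h2 := hy (fun j => p.eval (α ^ (j.val + 1))) ((mem_codeC α n k hk _).2
        ⟨p, by omega, coeff_eq_zero_of_natDegree_lt (by omega), fun _ => rfl⟩)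
      rw [dotProduct, Finset.sum_eq_single i] at h2
      · refine (mul_eq_zero.1 h2).resolve_left ?_
        rw [← ne_eq, hp, eval_prod, Finset.prod_ne_zero_iff]
        intro j hj
        rw [eval_sub, eval_X, eval_C, sub_ne_zero]
        exact fun h => Finset.ne_of_mem_erase hj (powers_injective hα h).symm
      · intro j _ hji
        by_cases hj : j ∈ T
        · rw [hp, eval_prod, Finset.prod_eq_zero (Finset.mem_erase.2 ⟨hji, hj⟩) (by simp), zero_mul]
        · rw [hyT j (by simpa using hj), mul_zero]
      · simp
    · exact hyT i (by simpa using hi)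

theorem vanishCount_codeC_of_gt {F : Type*} [Field F] {α : F} {n k : ℕ}
    (hα : IsPrimitiveRoot α n) (hk : 1 ≤ k) (T : Finset (Fin n))
    (hT : k < T.card) : vanishCount (codeC α n k) T = 1 := by
  classical
  refine vanishCount_eq_one _ _ fun c hc hcT => ?_
  obtain ⟨p, hp1, -, hp3⟩ := (mem_codeC α n k hk c).1 hc
  have hp0 : p = 0 := by
    refine eq_zero_of_natDegree_lt_card_of_eval_eq_zero' p
      (T.map ⟨_, powers_injective hα⟩) ?_ ?_
    · intro a ha
      obtain ⟨i, hi, rfl⟩ := Finset.mem_map.1 ha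
      exact (hp3 i).symm.trans (hcT i hi)
    · rw [Finset.card_map]
      omega
  ext i
  rw [hp3, hp0, eval_zero, Pi.zero_apply]

/-- A polynomial of degree at most `k` vanishing at the `k` points of `T` is a scalar times the
monic `g`. By Vieta, the scalar is free if the points sum to zero and must be zero otherwise. -/
theorem vanishCount_codeC_of_eq {F : Type*} [Field F] [Fintype F] [DecidableEq F] {α : F} {n k : ℕ}
    (hα : IsPrimitiveRoot α n) (hk : 1 ≤ k) (hkn : k < n) (T : Finset (Fin n))
    (hT : T.card = k) : vanishCount (codeC α n k) T =
      if ∑ i ∈ T, α ^ (i.val + 1) = 0 then Fintype.card F else 1 := by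
  set g : F[X] := ∏ j ∈ T, (X - C (α ^ (j.val + 1))) with hg
  have hgdeg : g.natDegree = k := by rw [hg, natDegree_finsetProd_X_sub_C_eq_card, hT]
  have hgm : g.Monic := monic_prod_of_monic _ _ fun _ _ => monic_X_sub_C _
  have hgc : g.coeff (k - 1) = -∑ i ∈ T, α ^ (i.val + 1) := by
    rw [← hT, hg, prod_X_sub_C_coeff_card_pred _ _ (by omega)]
  have hgT : ∀ i ∈ T, g.eval (α ^ (i.val + 1)) = 0 := by
    intro i hi
    rw [hg, eval_prod, Finset.prod_eq_zero hi (by simp)]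
  have hmul : ∀ p : F[X], p.natDegree ≤ k → (∀ i ∈ T, p.eval (α ^ (i.val + 1)) = 0) →
      p = C (p.coeff k) * g := by
    intro p hp hpT
    rw [← sub_eq_zero]
    refine eq_zero_of_natDegree_lt_card_of_eval_eq_zero' _
      (T.map ⟨_, powers_injective hα⟩) ?_ ?_
    · intro a ha
      obtain ⟨i, hi, rfl⟩ := Finset.mem_map.1 ha
      simp [hpT i hi, hgT i hi]
    · rw [Finset.card_map, hT]
      refine lt_of_le_of_lt (natDegree_le_pred (n := k) ?_ ?_) (by omega : k - 1 < k)
      · exact (natDegree_sub_le_of_le hp ((natDegree_C_mul_le _ _).trans hgdeg.le)).trans_eq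
          (max_self k)
      · have : g.coeff k = 1 := by rw [← hgdeg]; exact hgm.coeff_natDegree
        simp [this]
  split_ifs with h0
  -- A coordinate outside `T`, available as `k < n`; `g` is nonzero there, so distinct scalars give
  -- distinct codewords.
  · obtain ⟨i₀, hi₀⟩ : ∃ i₀, i₀ ∉ T := by
      by_contra! h
      have := Finset.card_univ (α := Fin n)
      rw [← Finset.eq_univ_iff_forall.2 h, Fintype.card_fin] at this
      omega
    have hg0 : g.eval (α ^ (i₀.val + 1)) ≠ 0 := by
      rw [hg, eval_prod, Finset.prod_ne_zero_iff]
      intro j hj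
      rw [eval_sub, eval_X, eval_C, sub_ne_zero]
      exact fun h => hi₀ ((powers_injective hα h) ▸ hj)
    have hset : {c : Fin n → F | c ∈ codeC α n k ∧ ∀ i ∈ T, c i = 0} =
        Set.range fun (a : F) (i : Fin n) => a * g.eval (α ^ (i.val + 1)) := by
      ext c
      constructor
      · rintro ⟨hc, hcT⟩
        obtain ⟨p, hp1, -, hp3⟩ := (mem_codeC α n k hk c).1 hc
        refine ⟨p.coeff k, ?_⟩
        ext i
        conv_rhs => rw [hp3, hmul p hp1 fun i hi => (hp3 i).symm.trans (hcT i hi)]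
        simp
      · rintro ⟨a, rfl⟩
        refine ⟨(mem_codeC α n k hk _).2 ⟨C a * g, (natDegree_C_mul_le _ _).trans hgdeg.le, ?_,
          fun i => by simp⟩, fun i hi => ?_⟩
        · rw [coeff_C_mul, hgc, h0, neg_zero, mul_zero]
        · simp [hgT i hi]
    rw [vanishCount, hset, ← Nat.card_coe_set_eq, Nat.card_range_of_injective,
      Nat.card_eq_fintype_card]
    intro a b hab
    exact mul_right_cancel₀ hg0 (congrFun hab i₀)
  · refine vanishCount_eq_one _ _ fun c hc hcT => ?_
    obtain ⟨p, hp1, hp2, hp3⟩ := (mem_codeC α n k hk c).1 hc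
    have hp := hmul p hp1 fun i hi => (hp3 i).symm.trans (hcT i hi)
    rw [hp, coeff_C_mul, hgc, mul_neg, neg_eq_zero] at hp2
    have h1 := (mul_eq_zero.1 hp2).resolve_right h0
    rw [h1, C_0, zero_mul] at hp
    ext i
    rw [hp3, hp, eval_zero, Pi.zero_apply]

/-- The evaluation points are all the nonzero elements, and each zero-sum `k`-set adds `q - 1`
nonzero codewords to the count. -/
theorem sum_vanishCount_codeC {F : Type*} [Field F] [Fintype F] [DecidableEq F] {α : F} {k : ℕ}
    (hα : IsPrimitiveRoot α (Fintype.card F - 1)) (hk : 1 ≤ k) (hkn : k < Fintype.card F - 1) :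
    ∑ T ∈ Finset.powersetCard k (Finset.univ : Finset (Fin (Fintype.card F - 1))),
      vanishCount (codeC α (Fintype.card F - 1) k) T = (Fintype.card F - 1).choose k +
        (Fintype.card F - 1) * subsetSumCount (Finset.univ.erase (0 : F)) k 0 := by
  set x : Fin (Fintype.card F - 1) ↪ F := ⟨_, powers_injective hα⟩ with hx
  have hx0 : α ≠ 0 := hα.ne_zero (by omega)
  have himg : Finset.univ.map x = Finset.univ.erase (0 : F) := by
    apply Finset.eq_of_subset_of_card_le
    · intro a ha
      obtain ⟨i, -, rfl⟩ := Finset.mem_map.1 ha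
      simp [hx, hx0]
    · rw [Finset.card_map, Finset.card_erase_of_mem (Finset.mem_univ _), Finset.card_univ,
        Finset.card_univ, Fintype.card_fin]
  have hM : subsetSumCount (Finset.univ.erase (0 : F)) k 0 = ((Finset.powersetCard k
      (Finset.univ : Finset (Fin (Fintype.card F - 1)))).filter
        fun T => ∑ i ∈ T, α ^ (i.val + 1) = 0).card := by
    rw [subsetSumCount, ← himg, Finset.powersetCard_map, Finset.filter_map, Finset.card_map]
    congr 2
    ext T
    simp [hx, Finset.sum_map]
  have h1 : ∀ T ∈ Finset.powersetCard k (Finset.univ : Finset (Fin (Fintype.card F - 1))),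
      vanishCount (codeC α (Fintype.card F - 1) k) T =
        1 + if ∑ i ∈ T, α ^ (i.val + 1) = 0 then Fintype.card F - 1 else 0 := by
    intro T hT
    rw [vanishCount_codeC_of_eq hα hk hkn T (Finset.mem_powersetCard.1 hT).2]
    split_ifs
    · omega
    · rfl
  rw [Finset.sum_congr rfl h1, Finset.sum_add_distrib, ← Finset.sum_filter, Finset.sum_const,
    Finset.sum_const, ← hM, Finset.card_powersetCard, Finset.card_univ, Fintype.card_fin]
  simp [mul_comm]

/-! ### Assembling both weight distributions -/

theorem weightEnumerator_eq {F ι : Type*} [Field F] [DecidableEq F] [Fintype ι]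
    (C : Submodule F (ι → F)) (n d : ℕ) (hn : Fintype.card ι = n) (hd : 0 < d)
    (h0 : weightCount C 0 = 1) (hlt : ∀ w, 0 < w → w < d → weightCount C w = 0) :
    weightEnumerator C =
      1 + ∑ i ∈ Finset.Icc d n, Polynomial.C (weightCount C i : ℤ) * X ^ i := by
  rw [weightEnumerator, hn, Finset.sum_range_eq_add_Ico _ (by omega), h0]
  congr 1
  · simp
  · symm
    apply Finset.sum_subset
    · intro i
      simp only [Finset.mem_Icc, Finset.mem_Ico]
      omega
    · intro i hi hi'
      simp only [Finset.mem_Icc, Finset.mem_Ico] at hi hi'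
      rw [hlt i (by omega) (by omega)]
      simp

/-- If every `t < k` coordinates of `C` carry the uniform distribution and no nonzero codeword has
more than `k` zeros, then `C^⊥` has the same property with `n - k` in place of `k`. -/
theorem vanishCount_dualCode_of_vanishCount {F ι : Type*} [Field F] [Fintype F] [Fintype ι]
    (C : Submodule F (ι → F)) (n k : ℕ) (hn : Fintype.card ι = n) (hkn : k < n)
    (hC : vanishCount C ∅ = Fintype.card F ^ k)
    (hlow : ∀ T : Finset ι, T.card < k → vanishCount C T = Fintype.card F ^ (k - T.card))
    (hhigh : ∀ T : Finset ι, k < T.card → vanishCount C T = 1) :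
    (∀ T : Finset ι, T.card < n - k →
      vanishCount (dualCode C) T = Fintype.card F ^ (n - k - T.card)) ∧
    (∀ T : Finset ι, n - k < T.card → vanishCount (dualCode C) T = 1) ∧
    ∑ T ∈ Finset.powersetCard (n - k) (Finset.univ : Finset ι), vanishCount (dualCode C) T =
      ∑ T ∈ Finset.powersetCard k (Finset.univ : Finset ι), vanishCount C T := by
  classical
  have hpos : ∀ m, 0 < Fintype.card F ^ m := fun m => pow_pos Fintype.card_pos m
  have key : ∀ T : Finset ι, vanishCount (dualCode C) T * Fintype.card F ^ k =
      Fintype.card F ^ (n - T.card) * vanishCount C Tᶜ := by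
    intro T
    have := vanishCount_dualCode C Tᶜ
    rwa [compl_compl, hC, Finset.card_compl, hn] at this
  have hle : ∀ T : Finset ι, T.card ≤ n := fun T => hn ▸ T.card_le_univ
  have hcompl : ∀ T : Finset ι, Tᶜ.card = n - T.card := fun T => by rw [Finset.card_compl, hn]
  refine ⟨fun T hT => ?_, fun T hT => ?_, ?_⟩
  · have h1 := key T
    rw [hhigh Tᶜ (by rw [hcompl]; omega), mul_one,
      show n - T.card = (n - k - T.card) + k by omega, pow_add] at h1
    exact Nat.eq_of_mul_eq_mul_right (hpos k) h1
  · have h1 := key T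
    have := hle T
    rw [hlow Tᶜ (by rw [hcompl]; omega), hcompl, ← pow_add,
      show n - T.card + (k - (n - T.card)) = k by omega] at h1
    exact Nat.eq_of_mul_eq_mul_right (hpos k) (by rw [h1, one_mul])
  · refine Finset.sum_nbij' (fun T => Tᶜ) (fun T => Tᶜ) ?_ ?_ ?_ ?_ ?_
    · intro T hT
      rw [Finset.mem_powersetCard] at hT ⊢
      exact ⟨Finset.subset_univ _, by rw [hcompl, hT.2]; omega⟩
    · intro T hT
      rw [Finset.mem_powersetCard] at hT ⊢
      exact ⟨Finset.subset_univ _, by rw [hcompl, hT.2]⟩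
    · intro T _
      exact compl_compl T
    · intro T _
      exact compl_compl T
    · intro T hT
      have h1 := key T
      rw [(Finset.mem_powersetCard.1 hT).2, show n - (n - k) = k by omega, mul_comm] at h1
      exact Nat.eq_of_mul_eq_mul_left (hpos k) h1

theorem mainTheorem3 {F : Type*} [Field F] [Fintype F] [DecidableEq F]
    (h q : ℕ) (hh : 3 ≤ h) (hq : q = 2 ^ h) (hF : Fintype.card F = q)
    (α : F) (hα : IsPrimitiveRoot α (q - 1))
    (k : ℕ) (hk3 : 3 ≤ k) (hkq : k ≤ q - 4) :
    -- the weight enumerators: no nonzero codeword has weight below `q - k - 1`, respectively `k`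
    weightEnumerator (codeC α (q - 1) k) =
        1 + ∑ i ∈ Finset.Icc (q - k - 1) (q - 1),
          Polynomial.C (weightCount (codeC α (q - 1) k) i : ℤ) * Polynomial.X ^ i ∧
      weightEnumerator (dualCode (codeC α (q - 1) k)) =
        1 + ∑ i ∈ Finset.Icc k (q - 1),
          Polynomial.C (weightCount (dualCode (codeC α (q - 1) k)) i : ℤ) * Polynomial.X ^ i ∧
      -- the numbers of codewords of minimum weight
      0 < weightCount (codeC α (q - 1) k) (q - k - 1) ∧
      0 < weightCount (dualCode (codeC α (q - 1) k)) k ∧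
      (weightCount (codeC α (q - 1) k) (q - k - 1) : ℚ) =
        lambdaOne q k * ((q : ℚ) - 1) ^ 2 * ((q : ℚ) - 2) / ((k : ℚ) * ((k : ℚ) - 1)) ∧
      (weightCount (dualCode (codeC α (q - 1) k)) k : ℚ) =
        lambdaOne q k * ((q : ℚ) - 1) ^ 2 * ((q : ℚ) - 2) / ((k : ℚ) * ((k : ℚ) - 1)) ∧
      -- the remaining entries of the two weight distributions
      (∀ s ∈ Finset.Icc 1 k,
        (weightCount (codeC α (q - 1) k) (q - 1 - k + s) : ℚ) =
          ((q - 1).choose (k - s) : ℚ) *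
            ∑ i ∈ Finset.range s,
              (-1) ^ i * ((q - 1 - k + s).choose i : ℚ) * ((q : ℚ) ^ (s - i) - 1) +
          (-1) ^ s * (k.choose s : ℚ) *
            (weightCount (codeC α (q - 1) k) (q - k - 1) : ℚ)) ∧
      (∀ s ∈ Finset.Icc 1 (q - 1 - k),
        (weightCount (dualCode (codeC α (q - 1) k)) (k + s) : ℚ) =
          ((q - 1).choose (k + s) : ℚ) *
            ∑ i ∈ Finset.range s,
              (-1) ^ i * ((k + s).choose i : ℚ) * ((q : ℚ) ^ (s - i) - 1) +
          (-1) ^ s * ((q - 1 - k).choose s : ℚ) *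
            (weightCount (dualCode (codeC α (q - 1) k)) k : ℚ)) := by
  subst hF
  have : CharP F 2 := charP_of_card_eq_prime_pow hq
  have h2 : 2 ∣ Fintype.card F := hq ▸ dvd_pow_self 2 (by omega)
  set n := Fintype.card F - 1 with hn
  set M := subsetSumCount (Finset.univ.erase (0 : F)) k 0 with hM
  have hMpos : 0 < M := subsetSumCount_zero_pos h2 k hk3 hkq
  have hkn : k < n := by omega
  have hlow := vanishCount_codeC_of_lt hα (by omega : 1 ≤ k) hkn
  have hhigh := vanishCount_codeC_of_gt hα (by omega : 1 ≤ k)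
  have hmid := sum_vanishCount_codeC hα (by omega : 1 ≤ k) hkn
  obtain ⟨dlow, dhigh, dmid⟩ := vanishCount_dualCode_of_vanishCount (codeC α n k) n k
    (Fintype.card_fin n) hkn (by rw [vanishCount_empty, finrank_codeC hα hkn]) hlow hhigh
  -- The dual plays the role of the code with `n - k` for `k`, so the binomial is reflected; the
  -- excess `n * M` is unchanged.
  rw [hmid, ← Nat.choose_symm hkn.le] at dmid
  obtain ⟨c0, clt, cmin, crest⟩ := weightCount_of_vanishCount (codeC α n k) n (Fintype.card F) k
    (n * M) (Fintype.card_fin n) hkn hlow hhigh hmid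
  obtain ⟨d0, dlt, dmin, drest⟩ := weightCount_of_vanishCount (dualCode (codeC α n k)) n
    (Fintype.card F) (n - k) (n * M) (Fintype.card_fin n) (by omega) dlow dhigh dmid
  rw [Nat.sub_sub_self hkn.le] at dlt dmin drest
  have hqk : Fintype.card F - k - 1 = n - k := by omega
  have hval : ((n * M : ℕ) : ℚ) = lambdaOne (Fintype.card F) k * ((Fintype.card F : ℚ) - 1) ^ 2 *
      ((Fintype.card F : ℚ) - 2) / ((k : ℚ) * ((k : ℚ) - 1)) := by
    have h3 := mul_subsetSumCount_zero (F := F) k (by omega)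
    have hk1 : (k : ℚ) - 1 ≠ 0 := by
      have : (3 : ℚ) ≤ k := by exact_mod_cast hk3
      linarith
    have hk0 : (k : ℚ) ≠ 0 := by
      have : (3 : ℚ) ≤ k := by exact_mod_cast hk3
      linarith
    rw [eq_div_iff (mul_ne_zero hk0 hk1), hn]
    push_cast [Nat.cast_sub Fintype.card_pos]
    linear_combination ((Fintype.card F : ℚ) - 1) * h3
  have hnM : 0 < n * M := Nat.mul_pos (by omega) hMpos
  rw [hqk, cmin, dmin]
  refine ⟨weightEnumerator_eq _ n (n - k) (Fintype.card_fin n) (by omega) c0 clt,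
    weightEnumerator_eq _ n k (Fintype.card_fin n) (by omega) d0 dlt, hnM, hnM, hval, hval,
    crest, fun s hs => ?_⟩
  rw [drest s hs]
  rw [Finset.mem_Icc] at hs
  -- The inversion formula yields `n.choose (n - k - s)`, indexed by zeros; reflection indexes it by
  -- weight.
  rw [← Nat.choose_symm (show k + s ≤ n by omega), show n - (k + s) = n - k - s by omega]
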